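/- The Fibonacci polynomials are defined by $F_0(x)=0$, $F_1(x)=1$ and $F_m(x)=xF_{m-1}(x)+F_{m-2}(x)$ for $m\ge 2$. For a nonnegative integer $q=\sum_i c_i2^i$ with $c_i\in\{0,1\}$ let $u_0(q)=\min\{i\ge 1: c_i=0\}$. A minimal decomposition of $\mathbb{Z}_p$ for a map $f:\mathbb{Z}_p\to\mathbb{Z}_p$ is a partition $\mathbb{Z}_p=\mathcal P\sqcup\bigsqcup_{i}\mathcal M_i\sqcup\mathcal B$ in which $\mathcal P$ is finite and is the set of all periodic points of $f$; the at most countably many sets $\mathcal M_i$ (the minimal components) are pairwise disjoint, nonempty, clopen, finite unions of balls, invariant under $f$, and each subsystem $f:\mathcal M_i\to\mathcal M_i$ is minimal (the forward orbit of every point of $\mathcal M_i$ is dense in $\mathcal M_i$); and each point of $\mathcal B$ lies in the attracting basin of a periodic orbit or of some $\mathcal M_i$ (that is, the distance from its $n$-th iterate to that set tends to $0$). Theorem. Let $q\ge 0$ be an integer with $q\equiv 3\pmod 4$, let $m=10+12q$ and $u=u_0(q)$. Then $0$ is a fixed point of $F_m$, and the minimal decomposition of $\mathbb{Z}_2$ for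 $x\mapsto F_m(x)$ is $$\mathbb{Z}_2=\{0\}\ \sqcup\ \Bigl(\bigsqcup_{k=0}^{2^{u+2}-1}A_k\ \sqcup\ \bigsqcup_{n\ge 1}\bigsqcup_{k=0}^{2^u-1}M_{n,k}\Bigr),$$ where $$A_k=(1+4k+2^{u+4}\mathbb{Z}_2)\cup(2^{u+3}-1-4k+2^{u+4}\mathbb{Z}_2),$$ $$M_{n,k}=\bigl((1+4k)2^n+2^{n+u+2}\mathbb{Z}_2\bigr)\cup\bigl((2^{u+1}-1-4k)2^n+2^{n+u+2}\mathbb{Z}_2\bigr).$$ Here $\mathcal P=\{0\}$, the minimal components are exactly the sets $A_k$ and $M_{n,k}$ with the indicated indices, and $\mathcal B=\emptyset$. -/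

import Mathlib

/-- The Fibonacci polynomials: `F₀ = 0`, `F₁ = 1`, `F_{m+2} = X F_{m+1} + F_m`. -/
noncomputable def fibPoly (R : Type*) [CommRing R] : ℕ → Polynomial R
  | 0 => 0
  | 1 => 1
  | m + 2 => Polynomial.X * fibPoly R (m + 1) + fibPoly R m

/-- The self-map `x ↦ F_m(x)` of the `2`-adic integers. -/
noncomputable def fibMap (m : ℕ) (x : ℤ_[2]) : ℤ_[2] := (fibPoly ℤ_[2] m).eval x

/-- `u₀(q)`: the least `i ≥ 1` such that the binary digit of `q` at `2 ^ i` is zero. -/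
noncomputable def u0 (q : ℕ) : ℕ := sInf {i : ℕ | 1 ≤ i ∧ q.testBit i = false}

/-- The ball `a + p ^ l ℤ_p`. -/
def padicBall {p : ℕ} [Fact p.Prime] (a : ℤ_[p]) (l : ℕ) : Set ℤ_[p] :=
  {x | ∃ y : ℤ_[p], x = a + (p : ℤ_[p]) ^ l * y}

/-- The forward orbit `{x, f x, f (f x), …}`. -/
def forwardOrbit {X : Type*} (f : X → X) (x : X) : Set X :=
  Set.range fun n : ℕ => f^[n] x

/-- `f : S → S` is a minimal subsystem: `S` is nonempty and invariant, and the forward orbit of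
each of its points is dense in `S`. -/
structure IsMinimalSubsystem {X : Type*} [TopologicalSpace X] (f : X → X) (S : Set X) :
    Prop where
  nonempty : S.Nonempty
  invariant : Set.MapsTo f S S
  dense_orbit : ∀ x ∈ S, S ⊆ closure (forwardOrbit f x)

/-- The attracting basin of a (nonempty) set `K`: the points whose orbits converge to `K`. -/
def attractingBasin {X : Type*} [PseudoMetricSpace X] (f : X → X) (K : Set X) : Set X :=
  {x | Filter.Tendsto (fun n : ℕ => Metric.infDist (f^[n] x) K) Filter.atTop (nhds 0)}

/-- `ℤ_p = P ⊔ (⨆ i, M i) ⊔ B` is a minimal decomposition for `f`, with (pairwise disjoint)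
minimal components `M i`. -/
structure IsMinimalDecomposition {p : ℕ} [Fact p.Prime] (f : ℤ_[p] → ℤ_[p]) {ι : Type*}
    (P : Set ℤ_[p]) (M : ι → Set ℤ_[p]) (B : Set ℤ_[p]) : Prop where
  union_eq : P ∪ (⋃ i, M i) ∪ B = Set.univ
  disjoint_P_M : Disjoint P (⋃ i, M i)
  disjoint_P_B : Disjoint P B
  disjoint_M_B : Disjoint (⋃ i, M i) B
  pairwise_disjoint : Pairwise fun i j => Disjoint (M i) (M j)
  periodic : P = Function.periodicPts f
  finite_periodic : P.Finite
  countable : Countable ι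
  isClopen : ∀ i, IsClopen (M i)
  finite_union_balls : ∀ i, ∃ s : Finset (ℤ_[p] × ℕ), M i = ⋃ c ∈ s, padicBall c.1 c.2
  minimal : ∀ i, IsMinimalSubsystem f (M i)
  attracted : ∀ x ∈ B, (∃ y ∈ Function.periodicPts f, x ∈ attractingBasin f (forwardOrbit f y)) ∨
    ∃ i, x ∈ attractingBasin f (M i)

/-- `A_k = (1 + 4k + 2^{u+4} ℤ₂) ∪ (2^{u+3} - 1 - 4k + 2^{u+4} ℤ₂)`. -/
def compA (u k : ℕ) : Set ℤ_[2] :=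
  padicBall (1 + 4 * (k : ℤ_[2])) (u + 4) ∪
    padicBall (2 ^ (u + 3) - 1 - 4 * (k : ℤ_[2])) (u + 4)

/-- `M_{n,k} = ((1 + 4k) 2^n + 2^{n+u+2} ℤ₂) ∪ ((2^{u+1} - 1 - 4k) 2^n + 2^{n+u+2} ℤ₂)`. -/
def compM (u n k : ℕ) : Set ℤ_[2] :=
  padicBall ((1 + 4 * (k : ℤ_[2])) * 2 ^ n) (n + u + 2) ∪
    padicBall ((2 ^ (u + 1) - 1 - 4 * (k : ℤ_[2])) * 2 ^ n) (n + u + 2)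

/-- The family consisting of all `A_k`, `k < 2^{u+2}`, and all `M_{n,k}`, `n ≥ 1`, `k < 2^u`. -/
def components (u : ℕ) : Fin (2 ^ (u + 2)) ⊕ (ℕ+ × Fin (2 ^ u)) → Set ℤ_[2] :=
  Sum.elim (fun k => compA u k) (fun nk => compM u nk.1 nk.2)

/-- The value at `x` of the Fibonacci polynomial `F_n`. -/
noncomputable def fibEval {R : Type*} [CommRing R] (x : R) (n : ℕ) : R := (fibPoly R n).eval x

/-! Write f for F_m. Since m = 2(6q+4) + 2, Cassini's identity gives f(x) + x = F_{6(q+1)}(x)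
L_{6q+4}(x) (`fibEval_add_self`). The hypothesis on q says q + 1 = 2^u w with w odd and u ≥ 2
(`u0_spec`). Doubling an index multiplies F by L, which is here twice an odd number, so valuations
can be read off exactly: on the sphere of valuation n, f(x) = -x + 2^(n+s) · odd, with s = u + 3 for
n = 0 and s = u + 1 for n ≥ 1. Hence f swaps the two balls of each component. Because 24 divides
6(q+1), increments of f satisfy f(x+t) = f(x) - t modulo 4t (`four_mul_dvd_increment`). As f is odd,
f ∘ f moves each point by an odd multiple of 2^(n+s+1), the modulus of the ball. The increment
property passes to iterates, so the 2^k-th iterate of f ∘ f moves points by odd multiples of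
2^(n+s+1+k): f ∘ f is transitive modulo every power of 2 on each ball
(`MovesByOdd.exists_iterate_dvd`), which is minimality. The components cover everything but 0, and
being infinite and minimal they contain no periodic points. -/

/-- The value at `x` of the Lucas polynomial `L_n = 2 F_{n+1} - x F_n`. -/
noncomputable def lucasEval {R : Type*} [CommRing R] (x : R) (n : ℕ) : R :=
  2 * fibEval x (n + 1) - x * fibEval x n

/-! ### Identities for Fibonacci and Lucas polynomials -/

section Identities

variable {R : Type*} [CommRing R] (x : R)

theorem fibEval_zero : fibEval x 0 = 0 := by simp [fibEval, fibPoly]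

theorem fibEval_one : fibEval x 1 = 1 := by simp [fibEval, fibPoly]

theorem fibEval_add_two (n : ℕ) :
    fibEval x (n + 2) = x * fibEval x (n + 1) + fibEval x n := by
  simp [fibEval, fibPoly]

theorem fibEval_add_add_one (m n : ℕ) :
    fibEval x (m + n + 1) =
      fibEval x (m + 1) * fibEval x (n + 1) + fibEval x m * fibEval x n := by
  induction n using Nat.twoStepInduction with
  | zero => simp [fibEval_zero, fibEval_one]
  | one =>
    rw [show m + 1 + 1 = m + 2 from rfl, fibEval_add_two, fibEval_add_two x 0, fibEval_zero,
      fibEval_one]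
    ring
  | more n h1 h2 =>
    rw [show m + (n + 2) + 1 = m + n + 1 + 2 by ring, fibEval_add_two,
      show m + n + 1 + 1 = m + (n + 1) + 1 by ring, h2, h1, fibEval_add_two x n,
      fibEval_add_two x (n + 1), fibEval_add_two x n]
    ring

theorem fibEval_add (m n : ℕ) :
    fibEval x (m + n) = fibEval x m * fibEval x (n + 1) + fibEval x (m + 1) * fibEval x n
      - x * fibEval x m * fibEval x n := by
  cases n with
  | zero => simp [fibEval_zero, fibEval_one]
  | succ n =>
    rw [← add_assoc, fibEval_add_add_one, fibEval_add_two]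
    ring

theorem fibEval_cassini (n : ℕ) :
    fibEval x (n + 1) ^ 2 - x * fibEval x (n + 1) * fibEval x n - fibEval x n ^ 2 = (-1) ^ n := by
  induction n with
  | zero => simp [fibEval_zero, fibEval_one]
  | succ n ih =>
    rw [fibEval_add_two, pow_succ (-1 : R), ← ih]
    ring

theorem fibEval_two_mul (n : ℕ) : fibEval x (2 * n) = fibEval x n * lucasEval x n := by
  rw [two_mul, fibEval_add, lucasEval]
  ring

theorem lucasEval_two_mul (n : ℕ) : lucasEval x (2 * n) = lucasEval x n ^ 2 - 2 * (-1) ^ n := by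
  rw [lucasEval, fibEval_two_mul, two_mul n, fibEval_add_add_one, ← fibEval_cassini x n, lucasEval]
  ring

theorem fibEval_add_self {k : ℕ} (hk : Even k) :
    fibEval x (2 * k + 2) + x = fibEval x (k + 2) * lucasEval x k := by
  have h := fibEval_cassini x k
  rw [hk.neg_one_pow] at h
  rw [show 2 * k + 2 = (k + 1) + k + 1 by ring, fibEval_add_add_one, lucasEval,
    show k + 1 + 1 = k + 2 from rfl, fibEval_add_two]
  linear_combination (-x) * h

theorem fibEval_neg (n : ℕ) : fibEval (-x) n = (-1) ^ (n + 1) * fibEval x n := by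
  induction n using Nat.twoStepInduction with
  | zero => simp [fibEval_zero]
  | one => simp [fibEval_one]
  | more n h1 h2 =>
    rw [fibEval_add_two, fibEval_add_two, h1, h2]
    ring

theorem fibEval_add_three (n : ℕ) :
    fibEval x (n + 3) = (x ^ 2 + 1) * fibEval x (n + 1) + x * fibEval x n := by
  rw [show n + 3 = n + 1 + 2 from rfl, fibEval_add_two, fibEval_add_two]
  ring

theorem sub_dvd_fibEval_sub (y : R) (n : ℕ) : x - y ∣ fibEval x n - fibEval y n :=
  Polynomial.sub_dvd_eval_sub _ _ _

theorem sub_dvd_lucasEval_sub (y : R) (n : ℕ) : x - y ∣ lucasEval x n - lucasEval y n := by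
  obtain ⟨a, ha⟩ := sub_dvd_fibEval_sub x y (n + 1)
  obtain ⟨b, hb⟩ := sub_dvd_fibEval_sub x y n
  refine ⟨2 * a - fibEval x n - y * b, ?_⟩
  rw [lucasEval, lucasEval]
  linear_combination 2 * ha - y * hb

end Identities

/-! ### Exact powers of 2 in Fibonacci and Lucas values -/

section Parity

variable {R : Type*} [CommRing R] {x : R}

theorem even_fibEval_three_mul (hx : Odd x) (n : ℕ) : Even (fibEval x (3 * n)) := by
  induction n with
  | zero => simp [fibEval_zero]
  | succ n ih =>
    rw [mul_add, mul_one, fibEval_add_three]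
    exact ((hx.pow.add_odd odd_one).mul_right _).add (ih.mul_left _)

theorem odd_fibEval_three_mul_add_one (hx : Odd x) (n : ℕ) : Odd (fibEval x (3 * n + 1)) := by
  induction n with
  | zero => simp [fibEval_one]
  | succ n ih =>
    rw [show 3 * (n + 1) + 1 = 3 * n + 1 + 3 by ring, fibEval_add_three]
    exact ((hx.pow.add_odd odd_one).mul_right _).add_odd (hx.mul ih)

theorem odd_lucasEval_three_mul_add_one (hx : Odd x) (n : ℕ) :
    Odd (lucasEval x (3 * n + 1)) :=
  (even_two_mul _).sub_odd (hx.mul (odd_fibEval_three_mul_add_one hx n))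

theorem even_lucasEval_of_even (hx : Even x) (n : ℕ) : Even (lucasEval x n) :=
  (even_two_mul _).sub (hx.mul_right _)

theorem even_lucasEval_three_mul (hx : Even x ∨ Odd x) (n : ℕ) : Even (lucasEval x (3 * n)) := by
  rcases hx with hx | hx
  · exact even_lucasEval_of_even hx _
  · exact (even_two_mul _).sub ((even_fibEval_three_mul hx n).mul_left _)

/-- L_{2n} = L_n² ∓ 2, and 4 divides L_n². -/
theorem lucasEval_two_mul_eq_two_mul_odd {n : ℕ} (h : Even (lucasEval x n)) :
    ∃ c, Odd c ∧ lucasEval x (2 * n) = 2 * c := by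
  obtain ⟨a, ha⟩ := h
  refine ⟨2 * a ^ 2 - (-1) ^ n, (even_two_mul _).sub_odd (odd_one.neg.pow), ?_⟩
  rw [lucasEval_two_mul, ha]
  ring

/-- Each doubling of the index contributes a Lucas factor that is exactly twice an odd element. -/
theorem fibEval_two_pow_mul {n : ℕ} {b : R} (hL : ∀ j, Even (lucasEval x (2 ^ j * n)))
    (hb : ∃ c, Odd c ∧ fibEval x (2 * n) = b * c) (j : ℕ) :
    ∃ c, Odd c ∧ fibEval x (2 ^ j * (2 * n)) = b * 2 ^ j * c := by
  induction j with
  | zero => simpa using hb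
  | succ j ih =>
    obtain ⟨c, hc, h⟩ := ih
    obtain ⟨d, hd, h'⟩ := lucasEval_two_mul_eq_two_mul_odd (hL j)
    refine ⟨c * d, hc.mul hd, ?_⟩
    rw [show 2 ^ (j + 1) * (2 * n) = 2 * (2 ^ j * (2 * n)) by ring, fibEval_two_mul, h,
      show 2 ^ j * (2 * n) = 2 * (2 ^ j * n) by ring, h']
    ring

/-- Shifting the index by 4 changes nothing modulo 2x: F_4 = x(x² + 2) vanishes there, and F_5 is
odd. -/
theorem fibEval_four_mul_add_two (hx : Even x) (i : ℕ) :
    ∃ c, Odd c ∧ fibEval x (4 * i + 2) = x * c := by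
  have h4 : fibEval x 4 = x ^ 3 + 2 * x := by
    simp only [fibEval_add_two, fibEval_zero, fibEval_one, zero_add]
    ring
  have h5 : fibEval x 5 = x ^ 4 + 3 * x ^ 2 + 1 := by
    simp only [fibEval_add_two, fibEval_zero, fibEval_one, zero_add]
    ring
  obtain ⟨y, rfl⟩ := hx
  induction i with
  | zero => exact ⟨1, odd_one, by simp [fibEval_add_two, fibEval_zero, fibEval_one]⟩
  | succ i ih =>
    obtain ⟨c, ⟨d, hd⟩, h⟩ := ih
    rw [show 4 * (i + 1) + 2 = 4 * i + 2 + 4 by ring, fibEval_add, h, h4, h5]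
    refine ⟨_, ⟨8 * y ^ 4 * c + 6 * y ^ 2 * c + d
      + (2 * y ^ 2 + 1) * (fibEval (y + y) (4 * i + 3) - 4 * y ^ 2 * c), rfl⟩, ?_⟩
    rw [hd, show 4 * i + 2 + 1 = 4 * i + 3 from rfl]
    ring

/-- F_6 = x(x² + 1)(x² + 3) is 8 times an odd element. Shifting the index by 12 preserves this,
since 16 divides F_12 and F_13 is odd. -/
theorem fibEval_twelve_mul_add_six (hx : Odd x) (hx2 : ∃ e, x ^ 2 = 8 * e + 1) (i : ℕ) :
    ∃ c, Odd c ∧ fibEval x (12 * i + 6) = 8 * c := by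
  obtain ⟨e, he⟩ := hx2
  have h6 : fibEval x 6 = x * (x ^ 2 + 1) * (x ^ 2 + 3) := by
    simp only [fibEval_add_two, fibEval_zero, fibEval_one, zero_add]
    ring
  have h12 : ∃ a, fibEval x 12 = 16 * a := by
    obtain ⟨d, -, h⟩ := lucasEval_two_mul_eq_two_mul_odd (even_lucasEval_three_mul (Or.inr hx) 1)
    refine ⟨x * (4 * e + 1) * (2 * e + 1) * d, ?_⟩
    rw [show 12 = 2 * (2 * (3 * 1)) from rfl, fibEval_two_mul, h,
      show 2 * (3 * 1) = 6 from rfl, h6, he]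
    ring
  obtain ⟨a, ha⟩ := h12
  obtain ⟨b, hb⟩ := odd_fibEval_three_mul_add_one hx 4
  induction i with
  | zero =>
    refine ⟨x * ((2 * (2 * e) + 1) * (2 * e + 1)),
      hx.mul ((odd_two_mul_add_one _).mul (odd_two_mul_add_one _)), ?_⟩
    rw [mul_zero, zero_add, h6, he]
    ring
  | succ i ih =>
    obtain ⟨c, ⟨d, hd⟩, h⟩ := ih
    rw [show 12 * (i + 1) + 6 = 12 * i + 6 + 12 by ring, fibEval_add, h, ha]
    refine ⟨_, ⟨b * c + d + a * fibEval x (12 * i + 7) - 8 * x * a * c, rfl⟩, ?_⟩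
    rw [show 3 * 4 + 1 = 12 + 1 from rfl] at hb
    rw [hb, hd, show 12 * i + 6 + 1 = 12 * i + 7 from rfl]
    ring

end Parity

/-- The increment of `F_{24 k} L_j` over `y - x` is divisible by `4 (y - x)`. -/
theorem four_mul_dvd_increment {R : Type*} [CommRing R] (hR : ∀ x : R, Even x ∨ Odd x)
    (k j : ℕ) (x y : R) :
    4 * (y - x) ∣ fibEval y (24 * k) * lucasEval y j - fibEval x (24 * k) * lucasEval x j := by
  -- The two factors of 2 come from L³ - 2L with L = L_{6k} even: it is divisible by 4, and its
  -- increment is that of L times an even element. The increment of L is itself divisible by 2(y -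
  -- x), because L = L_{3k}² ∓ 2 with L_{3k} even.
  have hF (z : R) : fibEval z (24 * k) = fibEval z (6 * k) * lucasEval z (6 * k)
      * (lucasEval z (6 * k) ^ 2 - 2) := by
    rw [show 24 * k = 2 * (2 * (6 * k)) by ring, fibEval_two_mul, fibEval_two_mul,
      lucasEval_two_mul, Even.neg_one_pow ⟨3 * k, by ring⟩]
    ring
  have hL (z : R) : lucasEval z (6 * k) = lucasEval z (3 * k) ^ 2 - 2 * (-1) ^ k := by
    rw [show 6 * k = 2 * (3 * k) by ring, lucasEval_two_mul, pow_mul]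
    norm_num
  obtain ⟨a, ha⟩ := sub_dvd_lucasEval_sub y x (3 * k)
  obtain ⟨b, hb⟩ := sub_dvd_fibEval_sub y x (6 * k)
  obtain ⟨c, hc⟩ := sub_dvd_lucasEval_sub y x j
  obtain ⟨v, hv⟩ := even_lucasEval_three_mul (hR x) k
  obtain ⟨w, hw⟩ := even_lucasEval_three_mul (hR y) k
  have hp : lucasEval y (6 * k) - lucasEval x (6 * k) = 2 * (y - x) * (a * (v + w)) := by
    rw [hL, hL, ← sub_eq_zero]
    linear_combination (lucasEval y (3 * k) + lucasEval x (3 * k)) * ha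
      + (y - x) * a * (hw + hv)
  have hE (z : R) : Even (lucasEval z (6 * k)) := by
    rw [show 6 * k = 3 * (2 * k) by ring]
    exact even_lucasEval_three_mul (hR z) _
  obtain ⟨v', hv'⟩ := hE x
  obtain ⟨w', hw'⟩ := hE y
  rw [hF, hF]
  rw [hv', hw'] at hp ⊢
  refine ⟨fibEval y (6 * k) * lucasEval y j * (a * (v + w))
      * (2 * (w' ^ 2 + w' * v' + v' ^ 2) - 1)
    + (fibEval y (6 * k) * c + b * lucasEval x j) * v' * (2 * v' ^ 2 - 1), ?_⟩
  linear_combination 2 * fibEval y (6 * k) * lucasEval y j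
      * (2 * (w' ^ 2 + w' * v' + v' ^ 2) - 1) * hp
    + 4 * v' * (2 * v' ^ 2 - 1) * (fibEval y (6 * k) * hc + lucasEval x j * hb)

/-! ### Divisibility, balls and closures in ℤ₂ -/

theorem even_or_odd_padicInt (x : ℤ_[2]) : Even x ∨ Odd x := by
  obtain ⟨n, hn, h⟩ := PadicInt.exists_mem_range (p := 2) x
  rw [PadicInt.maximalIdeal_eq_span_p, Ideal.mem_span_singleton] at h
  obtain ⟨c, hc⟩ := h
  push_cast at hc
  interval_cases n
  · left; exact ⟨c, by linear_combination hc⟩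
  · right; exact ⟨c, by linear_combination hc⟩

theorem not_two_dvd_of_odd {x : ℤ_[2]} (hx : Odd x) : ¬ (2 : ℤ_[2]) ∣ x := by
  rintro ⟨c, hc⟩
  obtain ⟨d, hd⟩ := hx
  have h : (2 : ℤ_[2]) * (c - d) = 1 := by linear_combination hd - hc
  have h2 : IsUnit (2 : ℤ_[2]) := IsUnit.of_mul_eq_one _ h
  have := PadicInt.prime_p (p := 2)
  exact this.not_isUnit (by exact_mod_cast h2)

theorem four_dvd_two_pow {l : ℕ} (hl : 2 ≤ l) : (4 : ℤ_[2]) ∣ 2 ^ l := by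
  rw [show (4 : ℤ_[2]) = 2 ^ 2 by norm_num]
  exact pow_dvd_pow 2 hl

theorem exists_eq_two_pow_mul_odd {x : ℤ_[2]} (hx : x ≠ 0) :
    ∃ (n : ℕ) (y : ℤ_[2]), Odd y ∧ x = 2 ^ n * y := by
  refine ⟨x.valuation, (PadicInt.unitCoeff hx : ℤ_[2]), ?_, ?_⟩
  · refine (even_or_odd_padicInt _).resolve_left fun h => ?_
    have := (PadicInt.prime_p (p := 2)).not_isUnit
    exact this (isUnit_of_dvd_unit (by exact_mod_cast h.two_dvd) (PadicInt.unitCoeff hx).isUnit)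
  · conv_lhs => rw [PadicInt.unitCoeff_spec hx]
    rw [mul_comm]; norm_cast

theorem mem_padicBall_iff (a x : ℤ_[2]) (l : ℕ) : x ∈ padicBall a l ↔ (2 : ℤ_[2]) ^ l ∣ x - a := by
  constructor
  · rintro ⟨y, rfl⟩; exact ⟨y, by push_cast; ring⟩
  · rintro ⟨y, hy⟩; exact ⟨y, by push_cast; linear_combination hy⟩

theorem padicBall_eq_closedBall (a : ℤ_[2]) (l : ℕ) :
    padicBall a l = Metric.closedBall a ((2 : ℝ) ^ (-(l : ℤ))) := by
  ext x
  rw [mem_padicBall_iff, Metric.mem_closedBall, dist_eq_norm]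
  have h := PadicInt.norm_le_pow_iff_mem_span_pow (p := 2) (x - a) l
  rw [Ideal.mem_span_singleton] at h
  exact_mod_cast h.symm

theorem isClopen_padicBall (a : ℤ_[2]) (l : ℕ) : IsClopen (padicBall a l) := by
  rw [padicBall_eq_closedBall]
  exact IsUltrametricDist.isClopen_closedBall _ (by positivity)

theorem infinite_padicBall (a : ℤ_[2]) (l : ℕ) : (padicBall a l).Infinite := by
  refine Set.infinite_of_injective_forall_mem (f := fun n : ℕ => a + 2 ^ l * (n : ℤ_[2])) ?_ ?_
  · intro m n h
    simpa using h
  · intro n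
    exact ⟨n, by push_cast; rfl⟩

theorem mem_closure_of_forall_dvd {S : Set ℤ_[2]} {z : ℤ_[2]}
    (h : ∀ j : ℕ, ∃ y ∈ S, (2 : ℤ_[2]) ^ j ∣ y - z) : z ∈ closure S := by
  rw [Metric.mem_closure_iff]
  intro ε hε
  obtain ⟨j, hj⟩ := exists_pow_lt_of_lt_one hε (by norm_num : (1 / 2 : ℝ) < 1)
  obtain ⟨y, hy, hd⟩ := h j
  refine ⟨y, hy, lt_of_le_of_lt ?_ hj⟩
  rw [← mem_padicBall_iff, padicBall_eq_closedBall, Metric.mem_closedBall, dist_comm] at hd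
  simpa using hd

/-! ### Transitivity of maps moving points by odd multiples of the modulus -/

section OddStep

/-- On the ball `a + 2^l ℤ_2`, `g` moves every point by an odd multiple of `2^l`. -/
def MovesByOdd (g : ℤ_[2] → ℤ_[2]) (a : ℤ_[2]) (b l : ℕ) : Prop :=
  ∀ x ∈ padicBall a b, ∃ c, Odd c ∧ g x = x + 2 ^ l * c

/-- The increments of `g` over `t ∈ 4 ℤ_2` are `ε t` modulo `4 t`. -/
def IncrementModFour (g : ℤ_[2] → ℤ_[2]) (ε : ℤ_[2]) : Prop :=
  ∀ x t, (4 : ℤ_[2]) ∣ t → ∃ c, g (x + t) = g x + ε * t + 4 * t * c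

theorem IncrementModFour.comp {g h : ℤ_[2] → ℤ_[2]} {ε η : ℤ_[2]} (hg : IncrementModFour g ε)
    (hh : IncrementModFour h η) : IncrementModFour (g ∘ h) (ε * η) := by
  intro x t ht
  obtain ⟨c, hc⟩ := hh x t ht
  obtain ⟨d, hd⟩ := hg (h x) (t * (η + 4 * c)) (ht.mul_right _)
  refine ⟨ε * c + (η + 4 * c) * d, ?_⟩
  rw [Function.comp_apply, Function.comp_apply, hc,
    show h x + η * t + 4 * t * c = h x + t * (η + 4 * c) by ring, hd]
  ring

variable {g : ℤ_[2] → ℤ_[2]} {a : ℤ_[2]} {b l : ℕ}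

theorem MovesByOdd.mem (h : MovesByOdd g a b l) (hbl : b ≤ l) {x : ℤ_[2]}
    (hx : x ∈ padicBall a b) : g x ∈ padicBall a b := by
  obtain ⟨c, -, hc⟩ := h x hx
  rw [mem_padicBall_iff] at hx ⊢
  rw [hc, show x + 2 ^ l * c - a = x - a + 2 ^ l * c by ring]
  exact hx.add ((pow_dvd_pow _ hbl).mul_right _)

/-- With t = 2^l c the first displacement, the second one is t modulo 4t, so the total is 2t times
an odd element. -/
theorem MovesByOdd.comp_self (h : MovesByOdd g a b l) (hg : IncrementModFour g 1)
    (hl : 2 ≤ l) : MovesByOdd (g ∘ g) a b (l + 1) := by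
  intro x hx
  obtain ⟨c, hc, h1⟩ := h x hx
  obtain ⟨e, he⟩ := hg x (2 ^ l * c)
    ((four_dvd_two_pow hl).mul_right _)
  refine ⟨c * (2 * e + 1), hc.mul (odd_two_mul_add_one e), ?_⟩
  rw [Function.comp_apply, h1, he, h1]
  ring

theorem MovesByOdd.iterate_two_pow (h : MovesByOdd g a b b) (hg : IncrementModFour g 1)
    (hb : 2 ≤ b) (k : ℕ) : MovesByOdd g^[2 ^ k] a b (b + k) ∧ IncrementModFour g^[2 ^ k] 1 := by
  induction k with
  | zero => exact ⟨by simpa using h, by simpa using hg⟩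
  | succ k ih =>
    have e : g^[2 ^ (k + 1)] = g^[2 ^ k] ∘ g^[2 ^ k] := by
      rw [← Function.iterate_add, pow_succ, mul_two]
    rw [e]
    exact ⟨ih.1.comp_self ih.2 (by omega), by simpa using ih.2.comp ih.2⟩

/-- A map with these two properties is transitive modulo every power of `2` on the ball. -/
theorem MovesByOdd.exists_iterate_dvd (h : MovesByOdd g a b b) (hg : IncrementModFour g 1)
    (hb : 2 ≤ b) {x z : ℤ_[2]} (hx : x ∈ padicBall a b) (hz : z ∈ padicBall a b) (k : ℕ) :
    ∃ n, g^[n] x ∈ padicBall a b ∧ (2 : ℤ_[2]) ^ (b + k) ∣ g^[n] x - z := by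
  induction k with
  | zero =>
    refine ⟨0, hx, ?_⟩
    rw [mem_padicBall_iff] at hx hz
    have := dvd_sub hx hz
    rwa [sub_sub_sub_cancel_right] at this
  | succ k ih =>
    obtain ⟨n, hn, d, hd⟩ := ih
    rcases even_or_odd_padicInt d with ⟨r, hr⟩ | ⟨r, hr⟩
    · refine ⟨n, hn, r, ?_⟩
      rw [hd, hr]; ring
    -- The error is an odd multiple of 2^(b+k); adding another odd multiple makes the quotient even.
    · have hm := (h.iterate_two_pow hg hb k).1
      obtain ⟨c, ⟨s, hs⟩, hc⟩ := hm _ hn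
      refine ⟨2 ^ k + n, ?_, r + s + 1, ?_⟩
      · rw [Function.iterate_add_apply]
        exact hm.mem (by omega) hn
      · rw [Function.iterate_add_apply, hc]
        rw [hr] at hd
        rw [hs]
        linear_combination hd

end OddStep

/-! ### Pairs of balls partitioning the spheres -/

section ReflectedPair

/-- The union of the balls of radius `2^{-(n+s+1)}` around `(1 + 4k) 2^n` and
`(2^s - 1 - 4k) 2^n`. -/
def reflectedPair (n s k : ℕ) : Set ℤ_[2] :=
  padicBall ((1 + 4 * (k : ℤ_[2])) * 2 ^ n) (n + s + 1) ∪
    padicBall ((2 ^ s - 1 - 4 * (k : ℤ_[2])) * 2 ^ n) (n + s + 1)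

theorem odd_one_add_four_mul (k : ℤ_[2]) : Odd (1 + 4 * k) := ⟨2 * k, by ring⟩

theorem odd_two_pow_sub {s : ℕ} (hs : s ≠ 0) {y : ℤ_[2]} (hy : Odd y) : Odd (2 ^ s - y) :=
  (even_two.pow_of_ne_zero hs).sub_odd hy

theorem mem_padicBall_odd_mul_iff {n s : ℕ} {y x : ℤ_[2]} (hy : Odd y) :
    x ∈ padicBall (y * 2 ^ n) (n + s + 1) ↔
      ∃ z, Odd z ∧ x = 2 ^ n * z ∧ (2 : ℤ_[2]) ^ (s + 1) ∣ z - y := by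
  rw [mem_padicBall_iff]
  constructor
  · rintro ⟨c, hc⟩
    refine ⟨y + 2 ^ (s + 1) * c,
      hy.add_even ((even_two.pow_of_ne_zero (Nat.succ_ne_zero s)).mul_right _), ?_, c, by ring⟩
    linear_combination hc
  · rintro ⟨z, -, rfl, c, hc⟩
    exact ⟨c, by linear_combination 2 ^ n * hc⟩

theorem mem_reflectedPair_iff {n s k : ℕ} (hs : s ≠ 0) {x : ℤ_[2]} :
    x ∈ reflectedPair n s k ↔ ∃ z, Odd z ∧ x = 2 ^ n * z ∧
      ((2 : ℤ_[2]) ^ (s + 1) ∣ z - (1 + 4 * k) ∨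
        (2 : ℤ_[2]) ^ (s + 1) ∣ z - (2 ^ s - (1 + 4 * k))) := by
  have h1 := odd_one_add_four_mul (k : ℤ_[2])
  rw [reflectedPair, Set.mem_union, mem_padicBall_odd_mul_iff h1, sub_sub,
    mem_padicBall_odd_mul_iff (odd_two_pow_sub hs h1)]
  constructor
  · rintro (⟨z, a, b, c⟩ | ⟨z, a, b, c⟩)
    · exact ⟨z, a, b, Or.inl c⟩
    · exact ⟨z, a, b, Or.inr c⟩
  · rintro ⟨z, a, b, c | c⟩
    · exact Or.inl ⟨z, a, b, c⟩
    · exact Or.inr ⟨z, a, b, c⟩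

theorem two_pow_mul_odd_injective {n n' : ℕ} {y y' : ℤ_[2]} (hy : Odd y) (hy' : Odd y')
    (h : (2 : ℤ_[2]) ^ n * y = 2 ^ n' * y') : n = n' ∧ y = y' := by
  wlog hnn : n ≤ n' generalizing n n' y y'
  · obtain ⟨a, b⟩ := this hy' hy h.symm (by omega)
    exact ⟨a.symm, b.symm⟩
  obtain ⟨d, rfl⟩ := Nat.exists_eq_add_of_le hnn
  rw [pow_add, mul_assoc] at h
  have h2 := mul_left_cancel₀ (pow_ne_zero n (two_ne_zero (α := ℤ_[2]))) h
  cases d with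
  | zero => exact ⟨rfl, by simpa using h2⟩
  | succ d =>
    refine absurd ?_ (not_two_dvd_of_odd hy)
    rw [h2, pow_succ]
    exact ⟨2 ^ d * y', by ring⟩

theorem two_pow_dvd_intCast_iff (l : ℕ) (a : ℤ) : (2 : ℤ_[2]) ^ l ∣ (a : ℤ_[2]) ↔ 2 ^ l ∣ a := by
  exact_mod_cast PadicInt.pow_p_dvd_int_iff (p := 2) l a

theorem exists_dvd_sub_one_add_four_mul {s : ℕ} (hs : 1 ≤ s) {y : ℤ_[2]} (hy : (4 : ℤ_[2]) ∣ y - 1) :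
    ∃ k < 2 ^ (s - 1), (2 : ℤ_[2]) ^ (s + 1) ∣ y - (1 + 4 * (k : ℕ)) := by
  have h1 := PadicInt.appr_lt y (s + 1)
  have h2 := PadicInt.appr_spec (s + 1) y
  rw [Ideal.mem_span_singleton] at h2
  set r := y.appr (s + 1)
  push_cast at h2
  have h4 : (2 : ℤ_[2]) ^ 2 ∣ (((r : ℤ) - 1 : ℤ) : ℤ_[2]) := by
    have h3 : (2 : ℤ_[2]) ^ 2 ∣ y - r := (pow_dvd_pow _ (by omega)).trans h2
    have := dvd_sub (show (2 : ℤ_[2]) ^ 2 ∣ y - 1 by norm_num; exact hy) h3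
    push_cast
    rwa [sub_sub_sub_cancel_left] at this
  rw [two_pow_dvd_intCast_iff] at h4
  obtain ⟨k, hk⟩ : ∃ k : ℕ, r = 1 + 4 * k := ⟨r / 4, by omega⟩
  refine ⟨k, ?_, ?_⟩
  · obtain ⟨t, rfl⟩ := Nat.exists_eq_add_of_le' hs
    rw [show t + 1 + 1 = t + 2 by rfl, pow_add] at h1
    simp only [Nat.add_sub_cancel]
    omega
  · rw [hk] at h2
    exact_mod_cast h2

theorem exists_mem_reflectedPair {n s : ℕ} (hs : 2 ≤ s) {y : ℤ_[2]} (hy : Odd y) :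
    ∃ k < 2 ^ (s - 1), 2 ^ n * y ∈ reflectedPair n s k := by
  have h4 := four_dvd_two_pow hs
  obtain ⟨d, hd⟩ := hy
  -- The residue of y modulo 4 selects the ball: 1 for the first, 3 for the reflected one.
  rcases even_or_odd_padicInt d with ⟨e, he⟩ | ⟨e, he⟩
  · obtain ⟨k, hk, h⟩ := exists_dvd_sub_one_add_four_mul (s := s) (y := y) (by omega)
      ⟨e, by rw [hd, he]; ring⟩
    exact ⟨k, hk, (mem_reflectedPair_iff (by omega)).2 ⟨y, ⟨d, hd⟩, rfl, Or.inl h⟩⟩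
  · obtain ⟨k, hk, h⟩ := exists_dvd_sub_one_add_four_mul (s := s) (y := 2 ^ s - y) (by omega) (by
      rw [sub_sub]
      exact dvd_sub h4 ⟨e + 1, by rw [hd, he]; ring⟩)
    refine ⟨k, hk, (mem_reflectedPair_iff (by omega)).2 ⟨y, ⟨d, hd⟩, rfl, Or.inr ?_⟩⟩
    rw [← dvd_neg]
    convert h using 1
    ring

theorem eq_of_dvd_four_mul_sub {s k k' : ℕ} (hs : 1 ≤ s) (hk : k < 2 ^ (s - 1))
    (hk' : k' < 2 ^ (s - 1)) (h : (2 : ℤ_[2]) ^ (s + 1) ∣ 4 * ((k : ℤ_[2]) - k')) : k = k' := by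
  obtain ⟨t, rfl⟩ := Nat.exists_eq_add_of_le' hs
  rw [show (4 * ((k : ℤ_[2]) - k')) = ((4 * ((k : ℤ) - k') : ℤ) : ℤ_[2]) by push_cast; ring,
    two_pow_dvd_intCast_iff, show t + 1 + 1 = t + 2 from rfl, pow_add, mul_comm,
    show (2 : ℤ) ^ 2 = 4 by norm_num] at h
  have h2 := (mul_dvd_mul_iff_left (by norm_num : (4 : ℤ) ≠ 0)).1 h
  simp only [Nat.add_sub_cancel] at hk hk'
  have h3 := Int.eq_zero_of_abs_lt_dvd h2 (by
    rw [abs_lt]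
    zify at hk hk'
    constructor <;> linarith [Int.natCast_nonneg k, Int.natCast_nonneg k'])
  omega

/-- As s ≥ 2, the two centres are 1 and 3 modulo 4. -/
theorem not_dvd_and_dvd {s k k' : ℕ} (hs : 2 ≤ s) {z : ℤ_[2]}
    (h : (2 : ℤ_[2]) ^ (s + 1) ∣ z - (1 + 4 * k))
    (h' : (2 : ℤ_[2]) ^ (s + 1) ∣ z - (2 ^ s - (1 + 4 * k'))) : False := by
  have h1 := dvd_sub h' h
  have h2 : (2 : ℤ_[2]) ^ 2 ∣ 2 ^ s := pow_dvd_pow 2 hs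
  have h3 : (2 : ℤ_[2]) ^ 2 ∣ 2 ^ (s + 1) := pow_dvd_pow 2 (by omega)
  obtain ⟨a, ha⟩ := h3.trans h1
  obtain ⟨b, hb⟩ := h2
  have h4 : (2 : ℤ_[2]) ^ 2 ∣ ((2 : ℤ) : ℤ_[2]) :=
    ⟨a + b - k - k', by push_cast; linear_combination ha + hb⟩
  rw [two_pow_dvd_intCast_iff] at h4
  omega

/-- The exponent s may depend on the sphere, so `hss` asks for agreement only once the valuations
agree. -/
theorem eq_of_mem_reflectedPair {n n' s s' k k' : ℕ} (hs : 2 ≤ s) (hs' : 2 ≤ s')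
    (hss : n = n' → s = s') (hk : k < 2 ^ (s - 1)) (hk' : k' < 2 ^ (s' - 1)) {x : ℤ_[2]}
    (hx : x ∈ reflectedPair n s k) (hx' : x ∈ reflectedPair n' s' k') : n = n' ∧ k = k' := by
  rw [mem_reflectedPair_iff (by omega)] at hx hx'
  obtain ⟨z, hz, rfl, h⟩ := hx
  obtain ⟨z', hz', he, h'⟩ := hx'
  obtain ⟨rfl, rfl⟩ := two_pow_mul_odd_injective hz hz' he
  obtain rfl := hss rfl
  refine ⟨rfl, ?_⟩
  rcases h with h | h <;> rcases h' with h' | h'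
  · refine eq_of_dvd_four_mul_sub (by omega) hk hk' ?_
    convert dvd_sub h' h using 1
    ring
  · exact (not_dvd_and_dvd hs h h').elim
  · exact (not_dvd_and_dvd hs h' h).elim
  · refine eq_of_dvd_four_mul_sub (by omega) hk hk' ?_
    convert dvd_sub h h' using 1
    ring

theorem isClopen_reflectedPair (n s k : ℕ) : IsClopen (reflectedPair n s k) :=
  (isClopen_padicBall _ _).union (isClopen_padicBall _ _)

theorem infinite_reflectedPair (n s k : ℕ) : (reflectedPair n s k).Infinite :=
  (infinite_padicBall _ _).mono Set.subset_union_left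

theorem exists_finset_reflectedPair (n s k : ℕ) :
    ∃ t : Finset (ℤ_[2] × ℕ), reflectedPair n s k = ⋃ c ∈ t, padicBall c.1 c.2 := by
  classical
  refine ⟨{((1 + 4 * (k : ℤ_[2])) * 2 ^ n, n + s + 1),
    ((2 ^ s - 1 - 4 * (k : ℤ_[2])) * 2 ^ n, n + s + 1)}, ?_⟩
  simp [reflectedPair]

end ReflectedPair

/-! ### Minimality on a reflected pair -/

section Minimality

variable {f : ℤ_[2] → ℤ_[2]} {n s : ℕ}

/-- On the sphere `2^n ℤ_2ˣ`, `f x = -x + 2^{n+s} c` with `c` odd. -/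
def ReflectsByOdd (f : ℤ_[2] → ℤ_[2]) (n s : ℕ) : Prop :=
  ∀ y, Odd y → ∃ c, Odd c ∧ f (2 ^ n * y) = -(2 ^ n * y) + 2 ^ (n + s) * c

/-- Modulo 2^(n+s+1) only the parity of c matters, so f acts on the ball as 2^(n+s) - x. -/
theorem ReflectsByOdd.mem_padicBall (h : ReflectsByOdd f n s) {y : ℤ_[2]} (hy : Odd y)
    {x : ℤ_[2]} (hx : x ∈ padicBall (y * 2 ^ n) (n + s + 1)) :
    f x ∈ padicBall ((2 ^ s - y) * 2 ^ n) (n + s + 1) := by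
  obtain ⟨z, hz, rfl, d, hd⟩ := (mem_padicBall_odd_mul_iff hy).1 hx
  obtain ⟨c, ⟨e, he⟩, hc⟩ := h z hz
  rw [mem_padicBall_iff, hc]
  refine ⟨e - d, ?_⟩
  rw [he]
  linear_combination -2 ^ n * hd

/-- With t = 2^(n+s) c, oddness gives f(-x) = x - t, and the increment property subtracts t again
modulo 4t: the total is -2t modulo 4t. -/
theorem ReflectsByOdd.movesByOdd_comp_self (h : ReflectsByOdd f n s) (hs : 2 ≤ s)
    (hodd : f.Odd) (hinc : IncrementModFour f (-1)) {y : ℤ_[2]} (hy : Odd y) :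
    MovesByOdd (f ∘ f) (y * 2 ^ n) (n + s + 1) (n + s + 1) := by
  intro x hx
  obtain ⟨z, hz, rfl, -⟩ := (mem_padicBall_odd_mul_iff hy).1 hx
  obtain ⟨c, hc, h1⟩ := h z hz
  obtain ⟨e, he⟩ := hinc (-(2 ^ n * z)) (2 ^ (n + s) * c)
    ((four_dvd_two_pow (by omega)).mul_right _)
  refine ⟨c * (2 * e - 1), hc.mul ((even_two_mul e).sub_odd odd_one), ?_⟩
  rw [Function.comp_apply, h1, he, hodd, h1]
  ring

theorem ReflectsByOdd.mem_closure_forwardOrbit (h : ReflectsByOdd f n s) (hs : 2 ≤ s)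
    (hodd : f.Odd) (hinc : IncrementModFour f (-1)) {y : ℤ_[2]} (hy : Odd y) {x z : ℤ_[2]}
    (hx : x ∈ padicBall (y * 2 ^ n) (n + s + 1)) (hz : z ∈ padicBall (y * 2 ^ n) (n + s + 1)) :
    z ∈ closure (forwardOrbit f x) := by
  refine mem_closure_of_forall_dvd fun j => ?_
  have hinc2 : IncrementModFour (f ∘ f) 1 := by simpa using hinc.comp hinc
  obtain ⟨k, -, hk⟩ := (h.movesByOdd_comp_self hs hodd hinc hy).exists_iterate_dvd hinc2
    (by omega) hx hz j
  refine ⟨_, ⟨2 * k, rfl⟩, (pow_dvd_pow _ (Nat.le_add_left j (n + s + 1))).trans ?_⟩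
  beta_reduce
  rw [Function.iterate_mul]
  exact hk

theorem forwardOrbit_apply_subset {X : Type*} (f : X → X) (x : X) :
    forwardOrbit f (f x) ⊆ forwardOrbit f x := by
  rintro _ ⟨k, rfl⟩
  exact ⟨k + 1, rfl⟩

theorem ReflectsByOdd.isMinimalSubsystem (h : ReflectsByOdd f n s) (hs : 2 ≤ s)
    (hodd : f.Odd) (hinc : IncrementModFour f (-1)) (k : ℕ) :
    IsMinimalSubsystem f (reflectedPair n s k) := by
  have h1 := odd_one_add_four_mul (k : ℤ_[2])
  have h2 : Odd ((2 : ℤ_[2]) ^ s - 1 - 4 * k) := by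
    rw [sub_sub]; exact odd_two_pow_sub (by omega) h1
  have m1 {x : ℤ_[2]} (hx : x ∈ padicBall ((1 + 4 * (k : ℤ_[2])) * 2 ^ n) (n + s + 1)) :
      f x ∈ padicBall ((2 ^ s - 1 - 4 * (k : ℤ_[2])) * 2 ^ n) (n + s + 1) := by
    rw [sub_sub]; exact h.mem_padicBall h1 hx
  have m2 {x : ℤ_[2]}
      (hx : x ∈ padicBall ((2 ^ s - 1 - 4 * (k : ℤ_[2])) * 2 ^ n) (n + s + 1)) :
      f x ∈ padicBall ((1 + 4 * (k : ℤ_[2])) * 2 ^ n) (n + s + 1) := by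
    convert h.mem_padicBall h2 hx using 2
    ring
  refine ⟨(infinite_reflectedPair n s k).nonempty, ?_, ?_⟩
  · rintro x (hx | hx)
    · exact Or.inr (m1 hx)
    · exact Or.inl (m2 hx)
  · rintro x (hx | hx) z (hz | hz)
    · exact h.mem_closure_forwardOrbit hs hodd hinc h1 hx hz
    · exact closure_mono (forwardOrbit_apply_subset f x)
        (h.mem_closure_forwardOrbit hs hodd hinc h2 (m1 hx) hz)
    · exact closure_mono (forwardOrbit_apply_subset f x)
        (h.mem_closure_forwardOrbit hs hodd hinc h1 (m2 hx) hz)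
    · exact h.mem_closure_forwardOrbit hs hodd hinc h2 hx hz

theorem finite_forwardOrbit_of_mem_periodicPts {X : Type*} {f : X → X} {x : X}
    (hx : x ∈ Function.periodicPts f) : (forwardOrbit f x).Finite := by
  obtain ⟨N, hN, hp⟩ := hx
  refine ((Set.finite_lt_nat N).image fun k => f^[k] x).subset ?_
  rintro _ ⟨k, rfl⟩
  exact ⟨k % N, Nat.mod_lt _ hN, hp.iterate_mod_apply k⟩

/-- A periodic orbit is finite, hence closed, and so cannot be dense in an infinite set. -/
theorem IsMinimalSubsystem.notMem_periodicPts {X : Type*} [TopologicalSpace X] [T1Space X]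
    {f : X → X} {S : Set X} (h : IsMinimalSubsystem f S) (hS : S.Infinite) {x : X} (hx : x ∈ S) :
    x ∉ Function.periodicPts f := by
  intro hp
  have hfin := finite_forwardOrbit_of_mem_periodicPts hp
  have := h.dense_orbit x hx
  rw [hfin.isClosed.closure_eq] at this
  exact hS (hfin.subset this)

end Minimality

/-! ### The map F_m on each sphere -/

section FibMap

theorem u0_spec {q : ℕ} (hq : q % 4 = 3) :
    2 ≤ u0 q ∧ ∃ w, Odd w ∧ q + 1 = 2 ^ u0 q * w := by
  have hne : {i : ℕ | 1 ≤ i ∧ q.testBit i = false}.Nonempty :=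
    ⟨q, by omega, Nat.testBit_lt_two_pow Nat.lt_two_pow_self⟩
  obtain ⟨h1, h2⟩ : 1 ≤ u0 q ∧ q.testBit (u0 q) = false := Nat.sInf_mem hne
  have hmin (i : ℕ) (hi : 1 ≤ i) (hiu : i < u0 q) : q.testBit i = true := by
    have := Nat.notMem_of_lt_sInf hiu
    simpa [hi] using this
  have hmod : q % 2 ^ u0 q = 2 ^ u0 q - 1 := by
    refine Nat.eq_of_testBit_eq fun i => ?_
    rw [Nat.testBit_mod_two_pow, Nat.testBit_two_pow_sub_one]
    -- The digits of q below `u0 q` are all 1; digit 0, which the minimum ignores, is 1 because q is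
    -- odd.
    rcases lt_or_ge i (u0 q) with hi | hi
    · rcases Nat.eq_zero_or_pos i with rfl | hi0
      · simp [Nat.testBit_zero, h1.trans_lt' Nat.zero_lt_one]; omega
      · simp [hi, hmin i hi0 hi]
    · simp [hi.not_gt]
  refine ⟨?_, q / 2 ^ u0 q + 1, ?_, ?_⟩
  · by_contra hlt
    have hu : u0 q = 1 := by omega
    rw [hu, Nat.testBit_eq_decide_div_mod_eq] at h2
    simp at h2
    omega
  · rw [Nat.testBit_eq_decide_div_mod_eq] at h2
    simp at h2
    rw [Nat.odd_iff]; omega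
  · have h3 := Nat.div_add_mod q (2 ^ u0 q)
    have h4 := Nat.one_le_two_pow (n := u0 q)
    rw [hmod] at h3
    rw [mul_add]
    omega

theorem fibMap_add_self (q : ℕ) (x : ℤ_[2]) :
    fibMap (10 + 12 * q) x + x = fibEval x (6 * (q + 1)) * lucasEval x (6 * q + 4) := by
  rw [show 10 + 12 * q = 2 * (6 * q + 4) + 2 by ring]
  exact fibEval_add_self x ⟨3 * q + 2, by ring⟩

theorem fibMap_odd (q : ℕ) : (fibMap (10 + 12 * q)).Odd := by
  intro x
  have h := fibEval_neg x (10 + 12 * q)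
  rw [Odd.neg_one_pow ⟨5 + 6 * q, by ring⟩, neg_one_mul] at h
  exact h

theorem fibMap_incrementModFour {q : ℕ} (hq : q % 4 = 3) :
    IncrementModFour (fibMap (10 + 12 * q)) (-1) := by
  intro x t _
  obtain ⟨c, hc⟩ := four_mul_dvd_increment even_or_odd_padicInt ((q + 1) / 4) (6 * q + 4) x (x + t)
  rw [show 24 * ((q + 1) / 4) = 6 * (q + 1) by omega, ← fibMap_add_self, ← fibMap_add_self] at hc
  exact ⟨c, by linear_combination hc⟩

theorem exists_sq_eq_eight_mul_add_one {x : ℤ_[2]} (hx : Odd x) : ∃ e, x ^ 2 = 8 * e + 1 := by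
  obtain ⟨d, rfl⟩ := hx
  rcases even_or_odd_padicInt d with ⟨e, rfl⟩ | ⟨e, rfl⟩
  · exact ⟨2 * e ^ 2 + e, by ring⟩
  · exact ⟨2 * e ^ 2 + 3 * e + 1, by ring⟩

variable {q u w : ℕ}

/-- For odd x, F_{6w} gives 2^3, the u doublings give 2^u, and L_{6q+4} is odd since 6q + 4 is 1
modulo 3. -/
theorem fibMap_reflectsByOdd_zero (hw : Odd w) (hq : q + 1 = 2 ^ u * w) :
    ReflectsByOdd (fibMap (10 + 12 * q)) 0 (u + 3) := by
  intro x hx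
  rw [pow_zero, one_mul]
  obtain ⟨i, hi⟩ := hw
  have h6 := fibEval_twelve_mul_add_six hx (exists_sq_eq_eight_mul_add_one hx) i
  rw [show 12 * i + 6 = 2 * (3 * w) by rw [hi]; ring] at h6
  obtain ⟨c, hc, h⟩ := fibEval_two_pow_mul (fun j => by
    rw [mul_left_comm]; exact even_lucasEval_three_mul (Or.inr hx) _) h6 u
  rw [show 2 ^ u * (2 * (3 * w)) = 6 * (q + 1) by rw [hq]; ring] at h
  have hL := odd_lucasEval_three_mul_add_one hx (2 * q + 1)
  rw [show 3 * (2 * q + 1) + 1 = 6 * q + 4 by ring] at hL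
  refine ⟨_, hc.mul hL, ?_⟩
  rw [eq_neg_add_iff_add_eq, add_comm, fibMap_add_self, h]
  ring

/-- For even x, F_{6w} is x times an odd element, the doublings give 2^u, and L_{6q+4} gives one
more factor 2. -/
theorem fibMap_reflectsByOdd {n : ℕ} (hn : n ≠ 0) (hw : Odd w) (hq : q + 1 = 2 ^ u * w) :
    ReflectsByOdd (fibMap (10 + 12 * q)) n (u + 1) := by
  intro y hy
  have hx : Even (2 ^ n * y) := (even_two.pow_of_ne_zero hn).mul_right _
  obtain ⟨i, hi⟩ := hw
  have h6 := fibEval_four_mul_add_two hx (3 * i + 1)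
  rw [show 4 * (3 * i + 1) + 2 = 2 * (3 * w) by rw [hi]; ring] at h6
  obtain ⟨c, hc, h⟩ := fibEval_two_pow_mul (fun j => even_lucasEval_of_even hx _) h6 u
  rw [show 2 ^ u * (2 * (3 * w)) = 6 * (q + 1) by rw [hq]; ring] at h
  obtain ⟨d, hd, hL⟩ := lucasEval_two_mul_eq_two_mul_odd (even_lucasEval_of_even hx (3 * q + 2))
  rw [show 2 * (3 * q + 2) = 6 * q + 4 by ring] at hL
  refine ⟨_, (hy.mul hc).mul hd, ?_⟩
  rw [eq_neg_add_iff_add_eq, add_comm, fibMap_add_self, h, hL]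
  ring

end FibMap

/-! ### Assembling the decomposition -/

theorem compA_eq_reflectedPair (u k : ℕ) : compA u k = reflectedPair 0 (u + 3) k := by
  simp [compA, reflectedPair, add_assoc]

theorem compM_eq_reflectedPair (u n k : ℕ) : compM u n k = reflectedPair n (u + 1) k := rfl

theorem mainTheorem9 (q m u : ℕ) (hq : q % 4 = 3) (hm : m = 10 + 12 * q) (hu : u = u0 q) :
    Function.IsFixedPt (fibMap m) 0 ∧
      IsMinimalDecomposition (fibMap m) {0} (components u) ∅ := by
  obtain ⟨hu2, w, hw, hqw⟩ := u0_spec hq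
  rw [← hu] at hu2 hqw
  subst hm
  have hodd := fibMap_odd q
  have hinc := fibMap_incrementModFour hq
  have hfix : Function.IsFixedPt (fibMap (10 + 12 * q)) 0 := hodd.map_zero
  have hmin (i) : IsMinimalSubsystem (fibMap (10 + 12 * q)) (components u i) := by
    rcases i with k | ⟨n, k⟩
    · simp only [components, Sum.elim_inl, compA_eq_reflectedPair]
      exact (fibMap_reflectsByOdd_zero hw hqw).isMinimalSubsystem (by omega) hodd hinc k
    · exact (fibMap_reflectsByOdd n.ne_zero hw hqw).isMinimalSubsystem (by omega) hodd hinc k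
  have hpair (i) : ∃ n s k, components u i = reflectedPair n s k := by
    rcases i with k | ⟨n, k⟩
    · exact ⟨_, _, _, compA_eq_reflectedPair u k⟩
    · exact ⟨_, _, _, compM_eq_reflectedPair u n k⟩
  have hcover (x : ℤ_[2]) (hx : x ≠ 0) : ∃ i, x ∈ components u i := by
    obtain ⟨n, y, hy, rfl⟩ := exists_eq_two_pow_mul_odd hx
    rcases Nat.eq_zero_or_pos n with rfl | hn
    · obtain ⟨k, hk, h⟩ := exists_mem_reflectedPair (n := 0) (s := u + 3) (by omega) hy
      refine ⟨Sum.inl ⟨k, hk⟩, ?_⟩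
      simpa only [components, Sum.elim_inl, compA_eq_reflectedPair] using h
    · obtain ⟨k, hk, h⟩ := exists_mem_reflectedPair (n := n) (s := u + 1) (by omega) hy
      exact ⟨Sum.inr ⟨⟨n, hn⟩, ⟨k, hk⟩⟩, h⟩
  have hnonper (i) (x : ℤ_[2]) (hx : x ∈ components u i) :
      x ∉ Function.periodicPts (fibMap (10 + 12 * q)) := by
    refine (hmin i).notMem_periodicPts ?_ hx
    obtain ⟨n, s, k, h⟩ := hpair i
    exact h ▸ infinite_reflectedPair n s k
  have h0 : (0 : ℤ_[2]) ∈ Function.periodicPts (fibMap (10 + 12 * q)) :=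
    ⟨1, one_pos, hfix.isPeriodicPt 1⟩
  refine ⟨hfix, ?_, ?_, ?_, ?_, ?_, ?_, ?_, ?_, ?_, ?_, hmin, ?_⟩
  · refine Set.eq_univ_of_forall fun x => Or.inl ?_
    by_cases hx : x = 0
    · exact Or.inl hx
    · exact Or.inr (Set.mem_iUnion.2 (hcover x hx))
  · rw [Set.disjoint_singleton_left, Set.mem_iUnion]
    rintro ⟨i, hi⟩
    exact hnonper i 0 hi h0
  · exact Set.disjoint_empty _
  · exact Set.disjoint_empty _
  · intro i j hij
    refine Set.disjoint_left.2 fun x hi hj => hij ?_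
    rcases i with k | ⟨n, k⟩ <;> rcases j with k' | ⟨n', k'⟩ <;>
      simp only [components, Sum.elim_inl, Sum.elim_inr, compA_eq_reflectedPair,
        compM_eq_reflectedPair] at hi hj
    · have h := eq_of_mem_reflectedPair (by omega) (by omega) (fun _ => rfl) k.2 k'.2 hi hj
      rw [Fin.ext h.2]
    · have h := eq_of_mem_reflectedPair (by omega) (by omega)
        (fun h => absurd h.symm n'.ne_zero) k.2 k'.2 hi hj
      exact absurd h.1.symm n'.ne_zero
    · have h := eq_of_mem_reflectedPair (by omega) (by omega)
        (fun h => absurd h n.ne_zero) k.2 k'.2 hi hj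
      exact absurd h.1 n.ne_zero
    · have h := eq_of_mem_reflectedPair (by omega) (by omega) (fun _ => rfl) k.2 k'.2 hi hj
      rw [PNat.eq h.1, Fin.ext h.2]
  · ext x
    refine ⟨fun hx => ?_, fun hx => ?_⟩
    · rw [Set.mem_singleton_iff.1 hx]
      exact h0
    · by_contra hx0
      obtain ⟨i, hi⟩ := hcover x hx0
      exact hnonper i x hi hx
  · exact Set.finite_singleton 0
  · infer_instance
  · intro i
    obtain ⟨n, s, k, h⟩ := hpair i
    exact h ▸ isClopen_reflectedPair n s k
  · intro i
    obtain ⟨n, s, k, h⟩ := hpair i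
    exact h ▸ exists_finset_reflectedPair n s k
  · exact fun x hx => hx.elim
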